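/- Let $I\subset\mathbb R$ be a nonempty open interval and let $s\mapsto (x(s),0,z(s))$, $s\in I$, be a smooth unit speed curve in the $xz$-plane with $x(s)>0$. Let $M$ be the surface of revolution in Euclidean $3$-space $\mathbb E^3$ parametrized by $$X(s,t)=(x(s)\cos t,\;x(s)\sin t,\;z(s)),\qquad s\in I,\ t\in\mathbb R,$$ with Gauss map $G=\dfrac{X_s\times X_t}{\|X_s\times X_t\|}$ and shape operator $S=-dG$. The Cheng–Yau operator of $M$ is $$\square f=-\operatorname{tr}\big((\operatorname{tr}(S)\,\mathrm{id}-S)\circ\nabla^2 f\big),$$ where $\mathrm{id}$ is the identity of the tangent plane and $\nabla^2 f$ is the self-adjoint operator metrically equivalent to the Hessian of $f$ for the induced metric; $\square$ acts on $\mathbb E^3$-valued functions coordinate by coordinate. Then the following are equivalent. 1) $M$ is an open part of a round sphere, that is, the set $X(I\times\mathbb R)$ is a relatively open subset of some sphere of positive radius in $\mathbb E^3$. 2) There is a nonsingular real $3\times 3$ matrix $A$ such that $\square G=AG$ on all of $M$. -/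

import Mathlib

open scoped ContDiff Matrix

noncomputable section

namespace RevolutionSurface

/-- Euclidean 3-space. -/
abbrev E3 : Type := EuclideanSpace ℝ (Fin 3)

/-! ### Local geometry of a parametrized surface in Euclidean 3-space

A parametrized surface is a map `X : ℝ → ℝ → E3`, `(s, t) ↦ X s t`; everything below is computed at a
point `(s, t)` from the germ of `X` there, and is meaningful where `X` is a smooth immersion.
Functions on the surface are read in the parameters, as `f : ℝ → ℝ → ℝ`. -/

/-- The coordinate vector fields `∂₀ = ∂/∂s` and `∂₁ = ∂/∂t` acting on functions of `(s, t)`. -/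
def pd {F : Type*} [NormedAddCommGroup F] [NormedSpace ℝ F] (i : Fin 2) (f : ℝ → ℝ → F) :
    ℝ → ℝ → F :=
  fun s t => ![deriv (fun s' => f s' t) s, deriv (fun t' => f s t') t] i

/-- The vector product of `E3`. -/
def cross (v w : E3) : E3 := WithLp.toLp 2 (crossProduct v.ofLp w.ofLp)

/-- The Gauss map: the unit normal `X_s × X_t / ‖X_s × X_t‖`. -/
def gaussMap (X : ℝ → ℝ → E3) : ℝ → ℝ → E3 :=
  fun s t => ‖cross (pd 0 X s t) (pd 1 X s t)‖⁻¹ • cross (pd 0 X s t) (pd 1 X s t)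

/-- The matrix `g i j = ⟪∂ᵢX, ∂ⱼX⟫` of the induced metric. -/
def metric (X : ℝ → ℝ → E3) (s t : ℝ) : Matrix (Fin 2) (Fin 2) ℝ :=
  Matrix.of fun i j => inner ℝ (pd i X s t) (pd j X s t)

/-- The matrix, in the basis `∂₀X, ∂₁X` of the tangent plane, of the shape operator `S = -dG` with
respect to the Gauss map `G`: from `-∂ⱼG = ∑ i, S i j • ∂ᵢX` one gets
`∑ i, g k i * S i j = -⟪∂ₖX, ∂ⱼG⟫`. -/
def shapeOperator (X : ℝ → ℝ → E3) (s t : ℝ) : Matrix (Fin 2) (Fin 2) ℝ :=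
  (metric X s t)⁻¹ * Matrix.of fun k j => -inner ℝ (pd k X s t) (pd j (gaussMap X) s t)

/-- The Christoffel symbols `Γᵏᵢⱼ` of the Levi-Civita connection of the induced metric. -/
def christoffel (X : ℝ → ℝ → E3) (k i j : Fin 2) (s t : ℝ) : ℝ :=
  (1 / 2 : ℝ) * ∑ l : Fin 2, (metric X s t)⁻¹ k l *
    (pd i (fun s t => metric X s t j l) s t + pd j (fun s t => metric X s t i l) s t
      - pd l (fun s t => metric X s t i j) s t)

/-- The Hessian `∂ᵢ∂ⱼf - ∑ k, Γᵏᵢⱼ ∂ₖf` of a function for the induced metric. -/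
def hessian (X : ℝ → ℝ → E3) (f : ℝ → ℝ → ℝ) (s t : ℝ) : Matrix (Fin 2) (Fin 2) ℝ :=
  Matrix.of fun i j => pd i (pd j f) s t - ∑ k : Fin 2, christoffel X k i j s t * pd k f s t

/-- The matrix of the linear operator `∇²f` of the tangent plane that is metrically equivalent to the
Hessian of `f`. -/
def hessianOperator (X : ℝ → ℝ → E3) (f : ℝ → ℝ → ℝ) (s t : ℝ) : Matrix (Fin 2) (Fin 2) ℝ :=
  (metric X s t)⁻¹ * hessian X f s t

/-- The first Newton transformation `P₁ = tr(S) I - S`. -/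
def newtonOne (X : ℝ → ℝ → E3) (s t : ℝ) : Matrix (Fin 2) (Fin 2) ℝ :=
  (shapeOperator X s t).trace • (1 : Matrix (Fin 2) (Fin 2) ℝ) - shapeOperator X s t

/-- The Cheng-Yau operator `□f = -tr(P₁ ∘ ∇²f)`. -/
def chengYau (X : ℝ → ℝ → E3) (f : ℝ → ℝ → ℝ) (s t : ℝ) : ℝ :=
  -(newtonOne X s t * hessianOperator X f s t).trace

/-- The Cheng-Yau operator on `E3`-valued functions, coordinate by coordinate. -/
def chengYauVec (X : ℝ → ℝ → E3) (F : ℝ → ℝ → E3) (s t : ℝ) : E3 :=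
  WithLp.toLp 2 fun i => chengYau X (fun s t => F s t i) s t

/-! ### Surfaces of revolution -/

/-- `s ↦ (x s, 0, z s)` is a smooth unit speed curve on the (nonempty) open interval `I`, in the
half-plane `x > 0` of the `xz`-plane. -/
structure IsProfileCurve (I : Set ℝ) (x z : ℝ → ℝ) : Prop where
  isOpen : IsOpen I
  isConnected : IsConnected I
  smooth_x : ContDiffOn ℝ ∞ x I
  smooth_z : ContDiffOn ℝ ∞ z I
  pos : ∀ s ∈ I, 0 < x s
  unit_speed : ∀ s ∈ I, deriv x s ^ 2 + deriv z s ^ 2 = 1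

/-- The parametrization `X(s,t) = (x(s) cos t, x(s) sin t, z(s))`. -/
def param (x z : ℝ → ℝ) (s t : ℝ) : E3 :=
  !₂[x s * Real.cos t, x s * Real.sin t, z s]

/-- The point set of the surface of revolution with profile curve `(x, 0, z)` on `I`. -/
def surface (I : Set ℝ) (x z : ℝ → ℝ) : Set E3 :=
  {p | ∃ s ∈ I, ∃ t : ℝ, param x z s t = p}

/-- `M` is a relatively open subset of some round sphere (of positive radius). -/
def IsOpenPartOfRoundSphere (M : Set E3) : Prop :=
  ∃ (c : E3) (r : ℝ), 0 < r ∧ ∃ U : Set E3, IsOpen U ∧ M = U ∩ Metric.sphere c r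

end RevolutionSurface

end

namespace RevolutionSurface

open Filter Topology

/-! Write k₁, k₂ for the meridian and parallel curvatures, K = k₁k₂ and T = k₁ + k₂. Everything
rests on □G = ∇K + T K G (`chengYauVec_gaussMap`). On a sphere K and T are constant, so □G is a
nonzero constant multiple of G.

Conversely, let □G = AG. Comparing both sides as functions of t forces A = diag(l, l, m), and
projecting on the tangent and the normal leaves K' = (m - l) x' z' and T K = l z'² + m x'²
(`exists_diagonal_of_matrix`). Cylinders and planes are excluded because they make A singular. The
core is l = m (`eq_of_gauss_curvature_system`): otherwise, where x'z' ≠ 0, the two equations and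
Codazzi form an overdetermined system, killed by repeated differentiation and elimination. Once l =
m, both K and T are constant, Codazzi gives k₁ = k₂ ≠ 0, and the surface is an open part of a
sphere. -/

/-! ### Elimination in an overdetermined system -/

/-- Each differentiation of the constraint yields a new algebraic relation in r and q, since g
factors out. The first removes u and m, the second eliminates q and leaves a quadratic in r, and the
third is incompatible with that quadratic. It is applied with u = k₂, r = k₁/k₂, q = (m - l)x²/k₂, g
= x'/x. -/
theorem no_solution_of_shape_system {J : Set ℝ} (hJ : IsOpen J) (hne : J.Nonempty)
    {u r q g : ℝ → ℝ} {m : ℝ}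
    (hu : ∀ s ∈ J, HasDerivAt u (g s * (u s * (r s - 1))) s)
    (hr : ∀ s ∈ J, HasDerivAt r (g s * (q s - 2 * r s * (r s - 1))) s)
    (hq : ∀ s ∈ J, HasDerivAt q (g s * (q s * (3 - r s))) s)
    (hm : ∀ s ∈ J, u s ^ 3 * (r s + r s ^ 2 + q s) = m)
    (hg0 : ∀ s ∈ J, g s ≠ 0) (hu0 : ∀ s ∈ J, u s ≠ 0) (hq0 : ∀ s ∈ J, q s ≠ 0) : False := by
  have key : ∀ {f : ℝ → ℝ} {c f' s : ℝ}, s ∈ J → (∀ σ ∈ J, f σ = c) → HasDerivAt f f' s →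
      f' = 0 := by
    intro f c f' s hs hf hd
    refine hd.unique ((hasDerivAt_const s c).congr_of_eventuallyEq ?_)
    filter_upwards [hJ.mem_nhds hs] with σ hσ using hf σ hσ
  have h1 : ∀ s ∈ J, q s * (1 + 4 * r s) - r s * (r s - 1) ^ 2 = 0 := by
    intro s hs
    have hd := ((hu s hs).pow 3).mul (((hr s hs).add ((hr s hs).pow 2)).add (hq s hs))
    have h := key hs hm hd
    have : (g s * u s ^ 3) * (q s * (1 + 4 * r s) - r s * (r s - 1) ^ 2) = 0 := by
      rw [← h]; push_cast; simp only [Pi.add_apply, Pi.pow_apply]; ring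
    exact (mul_eq_zero.1 this).resolve_left (mul_ne_zero (hg0 s hs) (pow_ne_zero _ (hu0 s hs)))
  have h2 : ∀ s ∈ J, 8 * r s ^ 2 + 17 * r s + 5 = 0 := by
    intro s hs
    have hd := ((hq s hs).mul (((hr s hs).const_mul 4).const_add 1)).sub
      ((hr s hs).mul (((hr s hs).sub_const 1).pow 2))
    have h := key hs h1 hd
    have e := h1 s hs
    have h' : q s * (3 - r s) * (1 + 4 * r s) +
        (q s - 2 * r s * (r s - 1)) * (4 * q s - (r s - 1) * (3 * r s - 1)) = 0 := by
      refine mul_left_cancel₀ (hg0 s hs) ?_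
      rw [mul_zero, ← h]; push_cast; simp only [Pi.pow_apply]; ring
    -- In the first relation, r = 0 or r = 1 would force q = 0.
    have hr0 : r s ≠ 0 := by
      intro h0
      rw [h0] at e
      exact hq0 s hs (by linarith)
    have hr1 : r s - 1 ≠ 0 := by
      intro h0
      have h0' : r s = 1 := by linarith
      rw [h0'] at e
      exact hq0 s hs (by linarith)
    have : r s ^ 2 * (r s - 1) ^ 2 * (5 * (8 * r s ^ 2 + 17 * r s + 5)) = 0 := by
      have e' : q s * (1 + 4 * r s) = r s * (r s - 1) ^ 2 := by linarith
      -- Scaling by (1 + 4r)² lets q(1 + 4r) be substituted without dividing by 1 + 4r, which is not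
      -- known to be nonzero.
      have h'' : (q s * (1 + 4 * r s)) * (3 - r s) * (1 + 4 * r s) ^ 2 +
        (q s * (1 + 4 * r s) - 2 * r s * (r s - 1) * (1 + 4 * r s)) *
          (4 * (q s * (1 + 4 * r s)) - (r s - 1) * (3 * r s - 1) * (1 + 4 * r s)) = 0 := by
        linear_combination (1 + 4 * r s) ^ 2 * h'
      rw [e'] at h''
      linear_combination h''
    have := (mul_eq_zero.1 this).resolve_left
      (mul_ne_zero (pow_ne_zero _ hr0) (pow_ne_zero _ hr1))
    linarith
  obtain ⟨s, hs⟩ := hne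
  have hd := ((((hr s hs).pow 2).const_mul 8).add ((hr s hs).const_mul 17)).add_const 5
  have h := key hs h2 hd
  have e1 := h1 s hs
  have e2 := h2 s hs
  have h' : (16 * r s + 17) * (q s - 2 * r s * (r s - 1)) = 0 := by
    refine mul_left_cancel₀ (hg0 s hs) ?_
    rw [mul_zero, ← h]; push_cast; ring
  rcases mul_eq_zero.1 h' with h3 | h3
  · have : r s = -17 / 16 := by linarith
    rw [this] at e2; norm_num at e2
  · have h4 : q s = 2 * r s * (r s - 1) := by linarith
    have hq := hq0 s hs
    rw [h4] at e1 hq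
    have h5 : (2 * r s * (r s - 1)) * (7 * r s + 3) = 0 := by linear_combination 2 * e1
    have h6 := (mul_eq_zero.1 h5).resolve_left hq
    have : r s = -3 / 7 := by linarith
    rw [this] at e2; norm_num at e2

/-! ### Calculus in the parameters -/

theorem hasDerivAt_vec3 {f₀ f₁ f₂ : ℝ → ℝ} {d₀ d₁ d₂ s : ℝ} (h₀ : HasDerivAt f₀ d₀ s)
    (h₁ : HasDerivAt f₁ d₁ s) (h₂ : HasDerivAt f₂ d₂ s) :
    HasDerivAt (fun s => (!₂[f₀ s, f₁ s, f₂ s] : E3)) !₂[d₀, d₁, d₂] s := by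
  have h : HasDerivAt (fun s => ![f₀ s, f₁ s, f₂ s]) ![d₀, d₁, d₂] s := by
    rw [hasDerivAt_pi]
    intro i
    fin_cases i
    exacts [h₀, h₁, h₂]
  exact (PiLp.hasFDerivAt_toLp (𝕜 := ℝ) 2 ![f₀ s, f₁ s, f₂ s]).comp_hasDerivAt s h

theorem inner_vec3 (a b c a' b' c' : ℝ) :
    inner ℝ (!₂[a, b, c] : E3) !₂[a', b', c'] = a * a' + b * b' + c * c' := by
  simp [PiLp.inner_apply, Fin.sum_univ_three]
  ring

theorem pd_zero_congr {F : Type*} [NormedAddCommGroup F] [NormedSpace ℝ F] {I : Set ℝ}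
    (hI : IsOpen I) {f g : ℝ → ℝ → F} {s t : ℝ} (hs : s ∈ I)
    (h : ∀ σ ∈ I, f σ t = g σ t) : pd 0 f s t = pd 0 g s t := by
  change deriv (fun σ => f σ t) s = deriv (fun σ => g σ t) s
  refine EventuallyEq.deriv_eq ?_
  filter_upwards [hI.mem_nhds hs] with σ hσ using h σ hσ

theorem pd_one_congr {F : Type*} [NormedAddCommGroup F] [NormedSpace ℝ F]
    {f g : ℝ → ℝ → F} {s t : ℝ} (h : ∀ τ, f s τ = g s τ) : pd 1 f s t = pd 1 g s t := by
  change deriv (fun τ => f s τ) t = deriv (fun τ => g s τ) t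
  rw [funext h]

theorem pd_zero_eq {F : Type*} [NormedAddCommGroup F] [NormedSpace ℝ F]
    {f : ℝ → ℝ → F} {d : F} {s t : ℝ} (h : HasDerivAt (fun σ => f σ t) d s) : pd 0 f s t = d :=
  h.deriv

theorem pd_one_eq {F : Type*} [NormedAddCommGroup F] [NormedSpace ℝ F]
    {f : ℝ → ℝ → F} {d : F} {s t : ℝ} (h : HasDerivAt (fun τ => f s τ) d t) : pd 1 f s t = d :=
  h.deriv

/-! ### Curvatures of the profile curve -/

/-- The curvature of the profile curve, which is the principal curvature along the meridians. -/
noncomputable def meridianCurvature (x z : ℝ → ℝ) (s : ℝ) : ℝ :=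
  deriv x s * deriv (deriv z) s - deriv (deriv x) s * deriv z s

/-- The principal curvature along the parallels. -/
noncomputable def parallelCurvature (x z : ℝ → ℝ) (s : ℝ) : ℝ := deriv z s / x s

namespace IsProfileCurve

variable {I : Set ℝ} {x z : ℝ → ℝ} {s : ℝ}

theorem hasDerivAt_x (hC : IsProfileCurve I x z) (hs : s ∈ I) : HasDerivAt x (deriv x s) s :=
  ((hC.smooth_x.contDiffAt (hC.isOpen.mem_nhds hs)).differentiableAt (by simp)).hasDerivAt

theorem hasDerivAt_z (hC : IsProfileCurve I x z) (hs : s ∈ I) : HasDerivAt z (deriv z s) s :=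
  ((hC.smooth_z.contDiffAt (hC.isOpen.mem_nhds hs)).differentiableAt (by simp)).hasDerivAt

theorem smooth_deriv_x (hC : IsProfileCurve I x z) : ContDiffOn ℝ ∞ (deriv x) I :=
  hC.smooth_x.deriv_of_isOpen hC.isOpen (by simp)

theorem smooth_deriv_z (hC : IsProfileCurve I x z) : ContDiffOn ℝ ∞ (deriv z) I :=
  hC.smooth_z.deriv_of_isOpen hC.isOpen (by simp)

theorem smooth_meridianCurvature (hC : IsProfileCurve I x z) :
    ContDiffOn ℝ ∞ (meridianCurvature x z) I :=
  (hC.smooth_deriv_x.mul (hC.smooth_deriv_z.deriv_of_isOpen hC.isOpen (by simp))).sub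
    ((hC.smooth_deriv_x.deriv_of_isOpen hC.isOpen (by simp)).mul hC.smooth_deriv_z)

theorem hasDerivAt_meridianCurvature (hC : IsProfileCurve I x z) (hs : s ∈ I) :
    HasDerivAt (meridianCurvature x z) (deriv (meridianCurvature x z) s) s :=
  ((hC.smooth_meridianCurvature.contDiffAt (hC.isOpen.mem_nhds hs)).differentiableAt
    (by simp)).hasDerivAt

theorem deriv_mul_add_deriv_mul (hC : IsProfileCurve I x z) (hs : s ∈ I) :
    deriv x s * deriv (deriv x) s + deriv z s * deriv (deriv z) s = 0 := by
  have ha := ((hC.smooth_deriv_x.contDiffAt (hC.isOpen.mem_nhds hs)).differentiableAt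
    (by simp)).hasDerivAt
  have hb := ((hC.smooth_deriv_z.contDiffAt (hC.isOpen.mem_nhds hs)).differentiableAt
    (by simp)).hasDerivAt
  have h1 := (ha.pow 2).add (hb.pow 2)
  have h2 : HasDerivAt (deriv x ^ 2 + deriv z ^ 2) 0 s := by
    refine (hasDerivAt_const s (1 : ℝ)).congr_of_eventuallyEq ?_
    filter_upwards [hC.isOpen.mem_nhds hs] with σ hσ using hC.unit_speed σ hσ
  have h3 := h1.unique h2
  push_cast at h3
  linear_combination h3 / 2

/-- Frenet equation: at unit speed the acceleration is k₁ times the normal (-z', x'). -/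
theorem hasDerivAt_deriv_x (hC : IsProfileCurve I x z) (hs : s ∈ I) :
    HasDerivAt (deriv x) (-(meridianCurvature x z s * deriv z s)) s := by
  have ha := ((hC.smooth_deriv_x.contDiffAt (hC.isOpen.mem_nhds hs)).differentiableAt
    (by simp)).hasDerivAt
  refine ha.congr_deriv ?_
  rw [meridianCurvature]
  linear_combination (deriv x s) * hC.deriv_mul_add_deriv_mul hs +
    (-deriv (deriv x) s) * hC.unit_speed s hs

theorem hasDerivAt_deriv_z (hC : IsProfileCurve I x z) (hs : s ∈ I) :
    HasDerivAt (deriv z) (meridianCurvature x z s * deriv x s) s := by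
  have hb := ((hC.smooth_deriv_z.contDiffAt (hC.isOpen.mem_nhds hs)).differentiableAt
    (by simp)).hasDerivAt
  refine hb.congr_deriv ?_
  rw [meridianCurvature]
  linear_combination (deriv z s) * hC.deriv_mul_add_deriv_mul hs +
    (-deriv (deriv z) s) * hC.unit_speed s hs

/-- This is the Codazzi equation of a surface of revolution. -/
theorem hasDerivAt_parallelCurvature (hC : IsProfileCurve I x z) (hs : s ∈ I) :
    HasDerivAt (parallelCurvature x z)
      (deriv x s / x s * (meridianCurvature x z s - parallelCurvature x z s)) s := by
  have h0 := (hC.pos s hs).ne'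
  refine ((hC.hasDerivAt_deriv_z hs).div (hC.hasDerivAt_x hs) h0).congr_deriv ?_
  rw [parallelCurvature]
  field_simp

/-! ### Gauss map, metric and shape operator -/

theorem pd_zero_param (hC : IsProfileCurve I x z) (hs : s ∈ I) (t : ℝ) :
    pd 0 (param x z) s t =
      !₂[deriv x s * Real.cos t, deriv x s * Real.sin t, deriv z s] :=
  pd_zero_eq (hasDerivAt_vec3 ((hC.hasDerivAt_x hs).mul_const _)
    ((hC.hasDerivAt_x hs).mul_const _) (hC.hasDerivAt_z hs))

end IsProfileCurve

theorem pd_one_param (x z : ℝ → ℝ) (s t : ℝ) :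
    pd 1 (param x z) s t = !₂[x s * -Real.sin t, x s * Real.cos t, 0] :=
  pd_one_eq (hasDerivAt_vec3 ((Real.hasDerivAt_cos t).const_mul _)
    ((Real.hasDerivAt_sin t).const_mul _) (hasDerivAt_const t _))

namespace IsProfileCurve

variable {I : Set ℝ} {x z : ℝ → ℝ} {s : ℝ}

theorem gaussMap_param (hC : IsProfileCurve I x z) (hs : s ∈ I) (t : ℝ) :
    gaussMap (param x z) s t =
      !₂[-deriv z s * Real.cos t, -deriv z s * Real.sin t, deriv x s] := by
  have hx := hC.pos s hs
  have hc : cross (pd 0 (param x z) s t) (pd 1 (param x z) s t) =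
      x s • (!₂[-deriv z s * Real.cos t, -deriv z s * Real.sin t, deriv x s] : E3) := by
    rw [hC.pd_zero_param hs, pd_one_param]
    ext i
    fin_cases i
    · simp [cross, crossProduct]; ring
    · simp [cross, crossProduct]; ring
    · simp [cross, crossProduct]
      linear_combination (x s * deriv x s) * Real.sin_sq_add_cos_sq t
  have hn : ‖(!₂[-deriv z s * Real.cos t, -deriv z s * Real.sin t, deriv x s] : E3)‖ = 1 := by
    rw [EuclideanSpace.norm_eq, Real.sqrt_eq_one, Fin.sum_univ_three]
    simp [mul_pow]
    linear_combination hC.unit_speed s hs + deriv z s ^ 2 * Real.sin_sq_add_cos_sq t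
  rw [gaussMap, hc, norm_smul, hn, smul_smul, Real.norm_of_nonneg hx.le, mul_one,
    inv_mul_cancel₀ hx.ne', one_smul]

theorem pd_zero_gaussMap (hC : IsProfileCurve I x z) (hs : s ∈ I) (t : ℝ) :
    pd 0 (gaussMap (param x z)) s t =
      -meridianCurvature x z s • pd 0 (param x z) s t := by
  rw [pd_zero_congr (g := fun s t =>
      !₂[-deriv z s * Real.cos t, -deriv z s * Real.sin t, deriv x s])
      hC.isOpen hs (fun σ hσ => hC.gaussMap_param hσ t),
    pd_zero_eq (hasDerivAt_vec3 ((hC.hasDerivAt_deriv_z hs).neg.mul_const _)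
    ((hC.hasDerivAt_deriv_z hs).neg.mul_const _) (hC.hasDerivAt_deriv_x hs)),
    hC.pd_zero_param hs]
  ext i
  fin_cases i <;> simp <;> ring

theorem pd_one_gaussMap (hC : IsProfileCurve I x z) (hs : s ∈ I) (t : ℝ) :
    pd 1 (gaussMap (param x z)) s t =
      -parallelCurvature x z s • pd 1 (param x z) s t := by
  have h0 := (hC.pos s hs).ne'
  rw [pd_one_congr (g := fun s t =>
      !₂[-deriv z s * Real.cos t, -deriv z s * Real.sin t, deriv x s])
      (fun τ => hC.gaussMap_param hs τ),
    pd_one_eq (hasDerivAt_vec3 ((Real.hasDerivAt_cos t).const_mul _)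
      ((Real.hasDerivAt_sin t).const_mul _) (hasDerivAt_const t _)),
    pd_one_param, parallelCurvature]
  ext i
  fin_cases i
  · simp; field_simp
  · simp; field_simp
  · simp

theorem metric_param (hC : IsProfileCurve I x z) (hs : s ∈ I) (t : ℝ) :
    metric (param x z) s t = !![1, 0; 0, x s ^ 2] := by
  have h := hC.unit_speed s hs
  have ht := Real.sin_sq_add_cos_sq t
  ext i j
  fin_cases i <;> fin_cases j <;>
    simp [metric, hC.pd_zero_param hs, pd_one_param, inner_vec3,
      -inner_self_eq_norm_sq_to_K]
  · linear_combination h + deriv x s ^ 2 * ht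
  · ring
  · ring
  · linear_combination x s ^ 2 * ht

theorem inv_metric_param (hC : IsProfileCurve I x z) (hs : s ∈ I) (t : ℝ) :
    (metric (param x z) s t)⁻¹ = !![1, 0; 0, (x s ^ 2)⁻¹] := by
  have h0 := (hC.pos s hs).ne'
  rw [hC.metric_param hs]
  refine Matrix.inv_eq_right_inv ?_
  ext i j
  fin_cases i <;> fin_cases j <;> simp [Matrix.mul_apply, h0]

theorem shapeOperator_param (hC : IsProfileCurve I x z) (hs : s ∈ I) (t : ℝ) :
    shapeOperator (param x z) s t =
      !![meridianCurvature x z s, 0; 0, parallelCurvature x z s] := by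
  have h0 := (hC.pos s hs).ne'
  have hm : ∀ k j, inner ℝ (pd k (param x z) s t) (pd j (param x z) s t) =
      (!![1, 0; 0, x s ^ 2] : Matrix (Fin 2) (Fin 2) ℝ) k j := fun k j => by
    rw [← hC.metric_param hs t]; rfl
  rw [shapeOperator, hC.inv_metric_param hs]
  ext i j
  fin_cases i <;> fin_cases j <;>
    simp [Matrix.mul_apply, hC.pd_zero_gaussMap hs, hC.pd_one_gaussMap hs, inner_smul_right, hm]
  field_simp

theorem pd_zero_metric (hC : IsProfileCurve I x z) (hs : s ∈ I) (t : ℝ) (i j : Fin 2) :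
    pd 0 (fun s t => metric (param x z) s t i j) s t =
      (!![0, 0; 0, 2 * x s * deriv x s] : Matrix (Fin 2) (Fin 2) ℝ) i j := by
  rw [pd_zero_congr (g := fun s _ => (!![1, 0; 0, x s ^ 2] : Matrix (Fin 2) (Fin 2) ℝ) i j)
    hC.isOpen hs (fun σ hσ => by rw [hC.metric_param hσ])]
  refine pd_zero_eq ?_
  fin_cases i <;> fin_cases j
  · exact hasDerivAt_const _ _
  · exact hasDerivAt_const _ _
  · exact hasDerivAt_const _ _
  · exact ((hC.hasDerivAt_x hs).pow 2).congr_deriv (by simp)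

theorem pd_one_metric (hC : IsProfileCurve I x z) (hs : s ∈ I) (t : ℝ) (i j : Fin 2) :
    pd 1 (fun s t => metric (param x z) s t i j) s t = 0 := by
  rw [pd_one_congr (g := fun s _ => (!![1, 0; 0, x s ^ 2] : Matrix (Fin 2) (Fin 2) ℝ) i j)
    (fun τ => by rw [hC.metric_param hs])]
  exact pd_one_eq (hasDerivAt_const _ _)

/-! ### Hessian and Cheng–Yau operator -/

theorem hessian_param_zero_zero (hC : IsProfileCurve I x z) (hs : s ∈ I) (t : ℝ)
    (f : ℝ → ℝ → ℝ) : hessian (param x z) f s t 0 0 = pd 0 (pd 0 f) s t := by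
  rw [hessian, Matrix.of_apply]
  simp only [christoffel, Fin.sum_univ_two, hC.inv_metric_param hs, hC.pd_zero_metric hs,
    hC.pd_one_metric hs]
  simp

theorem hessian_param_one_one (hC : IsProfileCurve I x z) (hs : s ∈ I) (t : ℝ)
    (f : ℝ → ℝ → ℝ) :
    hessian (param x z) f s t 1 1 = pd 1 (pd 1 f) s t + x s * deriv x s * pd 0 f s t := by
  rw [hessian, Matrix.of_apply]
  simp only [christoffel, Fin.sum_univ_two, hC.inv_metric_param hs, hC.pd_zero_metric hs,
    hC.pd_one_metric hs]
  simp
  left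
  ring

/-- The Newton transformation is diag(k₂, k₁), with the curvatures swapped, so only the diagonal
Hessian entries enter the trace. -/
theorem chengYau_param (hC : IsProfileCurve I x z) (hs : s ∈ I) (t : ℝ) (f : ℝ → ℝ → ℝ) :
    chengYau (param x z) f s t =
      -(parallelCurvature x z s * pd 0 (pd 0 f) s t + meridianCurvature x z s *
        ((x s ^ 2)⁻¹ * pd 1 (pd 1 f) s t + deriv x s / x s * pd 0 f s t)) := by
  have h0 := (hC.pos s hs).ne'
  rw [chengYau, newtonOne, hessianOperator, hC.shapeOperator_param hs, hC.inv_metric_param hs,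
    Matrix.trace_fin_two, Matrix.trace_fin_two]
  simp only [Matrix.mul_apply, Fin.sum_univ_two, Matrix.sub_apply, Matrix.smul_apply]
  simp [hC.hessian_param_zero_zero hs, hC.hessian_param_one_one hs]
  left
  field_simp

/-- Every coordinate of the Gauss map is a product h(s) φ(t), with φ = cos, sin or 1. -/
theorem chengYau_param_of_separated (hC : IsProfileCurve I x z) (hs : s ∈ I) (t : ℝ)
    {f : ℝ → ℝ → ℝ} {h h' φ φ' : ℝ → ℝ} {h'' φ'' : ℝ} (hf : ∀ σ ∈ I, ∀ t, f σ t = h σ * φ t)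
    (hh : ∀ σ ∈ I, HasDerivAt h (h' σ) σ) (hh' : HasDerivAt h' h'' s)
    (hφ : ∀ t, HasDerivAt φ (φ' t) t) (hφ' : HasDerivAt φ' φ'' t) :
    chengYau (param x z) f s t =
      -(parallelCurvature x z s * (h'' * φ t) + meridianCurvature x z s *
        ((x s ^ 2)⁻¹ * (h s * φ'') + deriv x s / x s * (h' s * φ t))) := by
  have h0 : ∀ σ ∈ I, pd 0 f σ t = h' σ * φ t := fun σ hσ => by
    rw [pd_zero_congr (g := fun s t => h s * φ t) hC.isOpen hσ (fun σ hσ => hf σ hσ t)]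
    exact pd_zero_eq ((hh σ hσ).mul_const _)
  have h1 : ∀ t, pd 1 f s t = h s * φ' t := fun t => by
    rw [pd_one_congr (g := fun s t => h s * φ t) (hf s hs)]
    exact pd_one_eq ((hφ t).const_mul _)
  have h00 : pd 0 (pd 0 f) s t = h'' * φ t := by
    rw [pd_zero_congr (g := fun s t => h' s * φ t) hC.isOpen hs h0]
    exact pd_zero_eq (hh'.mul_const _)
  have h11 : pd 1 (pd 1 f) s t = h s * φ'' := by
    rw [pd_one_congr (g := fun s t => h s * φ' t) h1]
    exact pd_one_eq (hφ'.const_mul _)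
  rw [hC.chengYau_param hs, h0 s hs, h00, h11]

/-- `□G = ∇K + tr(S) K G` for a surface of revolution. -/
theorem chengYauVec_gaussMap (hC : IsProfileCurve I x z) (hs : s ∈ I) (t : ℝ) {K' T K : ℝ}
    (hK' : HasDerivAt (fun s => meridianCurvature x z s * parallelCurvature x z s) K' s)
    (hT : T = meridianCurvature x z s + parallelCurvature x z s)
    (hK : K = meridianCurvature x z s * parallelCurvature x z s) :
    chengYauVec (param x z) (gaussMap (param x z)) s t =
      !₂[(K' * deriv x s - T * K * deriv z s) * Real.cos t,
        (K' * deriv x s - T * K * deriv z s) * Real.sin t,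
        K' * deriv z s + T * K * deriv x s] := by
  have h0 := (hC.pos s hs).ne'
  have ha := fun {s} (hs : s ∈ I) => hC.hasDerivAt_deriv_x hs
  have hb := fun {s} (hs : s ∈ I) => hC.hasDerivAt_deriv_z hs
  have hk := hC.hasDerivAt_meridianCurvature hs
  have hK2 := hK'.unique (hk.mul (hC.hasDerivAt_parallelCurvature hs))
  have hba : HasDerivAt (fun s => meridianCurvature x z s * deriv x s) _ s := hk.mul (ha hs)
  have hab : HasDerivAt (fun s => -(meridianCurvature x z s * deriv z s)) _ s :=
    (hk.mul (hb hs)).neg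
  have hp : deriv z s = parallelCurvature x z s * x s := by
    rw [parallelCurvature, div_mul_cancel₀ _ h0]
  have hu : deriv x s ^ 2 + (parallelCurvature x z s * x s) ^ 2 = 1 := by
    rw [← hp, hC.unit_speed s hs]
  have hcos : ∀ t, HasDerivAt (fun t => -Real.sin t) (-Real.cos t) t :=
    fun t => (Real.hasDerivAt_sin t).neg
  have e0 := hC.chengYau_param_of_separated hs t
    (fun σ hσ t => by rw [hC.gaussMap_param hσ]; rfl :
      ∀ σ ∈ I, ∀ t, gaussMap (param x z) σ t 0 = -deriv z σ * Real.cos t)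
    (fun σ hσ => (hb hσ).neg) hba.neg Real.hasDerivAt_cos (hcos t)
  have e1 := hC.chengYau_param_of_separated hs t
    (fun σ hσ t => by rw [hC.gaussMap_param hσ]; rfl :
      ∀ σ ∈ I, ∀ t, gaussMap (param x z) σ t 1 = -deriv z σ * Real.sin t)
    (fun σ hσ => (hb hσ).neg) hba.neg Real.hasDerivAt_sin (Real.hasDerivAt_cos t)
  have e2 := hC.chengYau_param_of_separated hs t
    (fun σ hσ t => by rw [hC.gaussMap_param hσ, mul_one]; rfl :
      ∀ σ ∈ I, ∀ t, gaussMap (param x z) σ t 2 = deriv x σ * 1)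
    (fun σ hσ => ha hσ) hab (fun t => hasDerivAt_const t 1) (hasDerivAt_const t 0)
  ext i
  fin_cases i
  · refine e0.trans ?_
    simp only [hK2, hT, hK, hp]
    simp
    field_simp
    linear_combination Real.cos t * meridianCurvature x z s * parallelCurvature x z s * hu
  · refine e1.trans ?_
    simp only [hK2, hT, hK, hp]
    simp
    field_simp
    linear_combination Real.sin t * meridianCurvature x z s * parallelCurvature x z s * hu
  · refine e2.trans ?_
    simp only [hK2, hT, hK, hp]
    simp
    field_simp
    ring

/-! ### Spheres satisfy the equation -/

theorem eqOn_const_of_hasDerivAt_zero (hC : IsProfileCurve I x z) {f : ℝ → ℝ}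
    (hf : ∀ s ∈ I, HasDerivAt f 0 s) : ∃ c, ∀ s ∈ I, f s = c :=
  hC.isOpen.exists_is_const_of_deriv_eq_zero hC.isConnected.isPreconnected
    (fun s hs => (hf s hs).differentiableAt.differentiableWithinAt) (fun s hs => (hf s hs).deriv)

theorem eq_zero_of_hasDerivAt_of_eqOn_const (hC : IsProfileCurve I x z) {f : ℝ → ℝ} {f' c : ℝ}
    (hs : s ∈ I) (hf : HasDerivAt f f' s) (h : ∀ s ∈ I, f s = c) : f' = 0 := by
  refine hf.unique ((hasDerivAt_const s c).congr_of_eventuallyEq ?_)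
  filter_upwards [hC.isOpen.mem_nhds hs] with σ hσ using h σ hσ

theorem exists_profile_sphere (hC : IsProfileCurve I x z)
    (h : IsOpenPartOfRoundSphere (surface I x z)) :
    ∃ c r : ℝ, 0 < r ∧ ∀ s ∈ I, x s ^ 2 + (z s - c) ^ 2 = r ^ 2 := by
  obtain ⟨c, r, hr, U, -, hM⟩ := h
  have key : ∀ s ∈ I, ∀ t, (x s * Real.cos t - c 0) ^ 2 + (x s * Real.sin t - c 1) ^ 2 +
      (z s - c 2) ^ 2 = r ^ 2 := by
    intro s hs t
    have hp : param x z s t ∈ surface I x z := ⟨s, hs, t, rfl⟩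
    rw [hM] at hp
    have hd := hp.2
    rw [Metric.mem_sphere, EuclideanSpace.dist_eq, Fin.sum_univ_three] at hd
    have := Real.sq_sqrt (show 0 ≤ dist (param x z s t 0) (c 0) ^ 2 +
      dist (param x z s t 1) (c 1) ^ 2 + dist (param x z s t 2) (c 2) ^ 2 by positivity)
    rw [hd] at this
    simp only [Real.dist_eq, sq_abs] at this
    exact this.symm
  refine ⟨c 2, r, hr, fun s hs => ?_⟩
  have hx := hC.pos s hs
  -- Opposite points of a parallel are equidistant from the centre, which puts the centre on the
  -- axis.
  have k1 := key s hs 0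
  have k2 := key s hs Real.pi
  have k3 := key s hs (Real.pi / 2)
  have k4 := key s hs (-(Real.pi / 2))
  simp at k1 k2 k3 k4
  have c0 : c 0 = 0 := by
    have : 4 * x s * c 0 = 0 := by linear_combination k2 - k1
    exact (mul_eq_zero.1 this).resolve_left (by positivity)
  have c1 : c 1 = 0 := by
    have : 4 * x s * c 1 = 0 := by linear_combination k4 - k3
    exact (mul_eq_zero.1 this).resolve_left (by positivity)
  rw [c0, c1] at k1
  linear_combination k1

/-- The constant m is the support function x z' - (z - c) x', a signed radius. Differentiating the
circle equation twice gives k₁ m = 1. -/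
theorem exists_curvatures_of_sphere (hC : IsProfileCurve I x z) {c r : ℝ}
    (h : ∀ s ∈ I, x s ^ 2 + (z s - c) ^ 2 = r ^ 2) :
    ∃ m : ℝ, ∀ s ∈ I, meridianCurvature x z s * m = 1 ∧ parallelCurvature x z s * m = 1 := by
  have h1 : ∀ s ∈ I, x s * deriv x s + (z s - c) * deriv z s = 0 := by
    intro s hs
    have := hC.eq_zero_of_hasDerivAt_of_eqOn_const hs
      (((hC.hasDerivAt_x hs).pow 2).add (((hC.hasDerivAt_z hs).sub_const c).pow 2)) h
    push_cast at this
    linear_combination this / 2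
  have h2 : ∀ s ∈ I,
      meridianCurvature x z s * (x s * deriv z s - (z s - c) * deriv x s) = 1 := by
    intro s hs
    have := hC.eq_zero_of_hasDerivAt_of_eqOn_const hs
      (((hC.hasDerivAt_x hs).mul (hC.hasDerivAt_deriv_x hs)).add
        (((hC.hasDerivAt_z hs).sub_const c).mul (hC.hasDerivAt_deriv_z hs))) h1
    linear_combination hC.unit_speed s hs - this
  obtain ⟨m, hm⟩ := hC.eqOn_const_of_hasDerivAt_zero
    (f := fun s => x s * deriv z s - (z s - c) * deriv x s) (fun s hs => by
      refine (((hC.hasDerivAt_x hs).mul (hC.hasDerivAt_deriv_z hs)).sub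
        (((hC.hasDerivAt_z hs).sub_const c).mul (hC.hasDerivAt_deriv_x hs))).congr_deriv ?_
      linear_combination meridianCurvature x z s * h1 s hs)
  refine ⟨m, fun s hs => ⟨by rw [← hm s hs, h2 s hs], ?_⟩⟩
  have h0 := (hC.pos s hs).ne'
  rw [parallelCurvature, div_mul_eq_mul_div, div_eq_one_iff_eq h0, ← hm s hs]
  linear_combination x s * hC.unit_speed s hs - deriv x s * h1 s hs

theorem exists_matrix_of_isOpenPartOfRoundSphere (hC : IsProfileCurve I x z)
    (h : IsOpenPartOfRoundSphere (surface I x z)) :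
    ∃ A : Matrix (Fin 3) (Fin 3) ℝ, A.det ≠ 0 ∧ ∀ s ∈ I, ∀ t : ℝ,
      chengYauVec (param x z) (gaussMap (param x z)) s t =
        WithLp.toLp 2 (A *ᵥ (gaussMap (param x z) s t).ofLp) := by
  obtain ⟨c, r, -, hr⟩ := hC.exists_profile_sphere h
  obtain ⟨m, hm⟩ := hC.exists_curvatures_of_sphere hr
  have hm0 : m ≠ 0 := by
    obtain ⟨s, hs⟩ := hC.isConnected.nonempty
    rintro rfl
    simpa using (hm s hs).1
  have hk1 : ∀ s ∈ I, meridianCurvature x z s = m⁻¹ :=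
    fun s hs => eq_inv_of_mul_eq_one_left (hm s hs).1
  have hk2 : ∀ s ∈ I, parallelCurvature x z s = m⁻¹ :=
    fun s hs => eq_inv_of_mul_eq_one_left (hm s hs).2
  -- Both curvatures are 1/m, so ∇K = 0 and T K = 2/m³.
  refine ⟨(2 * m⁻¹ ^ 3) • (1 : Matrix (Fin 3) (Fin 3) ℝ), ?_, fun s hs t => ?_⟩
  · rw [Matrix.det_smul, Matrix.det_one]
    positivity
  · have hK : HasDerivAt (fun s => meridianCurvature x z s * parallelCurvature x z s) 0 s := by
      refine (hasDerivAt_const s (m⁻¹ * m⁻¹)).congr_of_eventuallyEq ?_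
      filter_upwards [hC.isOpen.mem_nhds hs] with σ hσ
      rw [hk1 σ hσ, hk2 σ hσ]
    rw [hC.chengYauVec_gaussMap hs t hK rfl rfl, hC.gaussMap_param hs, hk1 s hs, hk2 s hs,
      Matrix.smul_mulVec, Matrix.one_mulVec]
    ext i
    fin_cases i
    · simp; ring
    · simp; ring
    · simp; left; ring

/-! ### Umbilical surfaces are open parts of spheres -/

theorem isOpenPartOfRoundSphere_of_curvatures_eq (hC : IsProfileCurve I x z) {k : ℝ}
    (hk : k ≠ 0) (h1 : ∀ s ∈ I, meridianCurvature x z s = k)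
    (h2 : ∀ s ∈ I, parallelCurvature x z s = k) :
    IsOpenPartOfRoundSphere (surface I x z) := by
  have hb : ∀ s ∈ I, deriv z s = k * x s := fun s hs => by
    rw [← h2 s hs, parallelCurvature, div_mul_cancel₀ _ (hC.pos s hs).ne']
  -- The centre is X + G/k; this is its height.
  obtain ⟨c, hc⟩ := hC.eqOn_const_of_hasDerivAt_zero (f := fun s => z s + deriv x s / k)
    (fun s hs => by
      refine ((hC.hasDerivAt_z hs).add ((hC.hasDerivAt_deriv_x hs).div_const k)).congr_deriv ?_
      rw [h1 s hs]
      field_simp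
      ring)
  have hsph : ∀ s ∈ I, x s ^ 2 + (z s - c) ^ 2 = |k|⁻¹ ^ 2 := by
    intro s hs
    have hu := hC.unit_speed s hs
    rw [hb s hs] at hu
    rw [← hc s hs, inv_pow, sq_abs]
    field_simp
    linear_combination hu
  -- Since z' = kx ≠ 0, z is an open map on I, so the surface is cut out of the sphere by the open
  -- condition that the height lies in z(I).
  have hopen : IsOpen (z '' I) := by
    rw [isOpen_iff_mem_nhds]
    rintro _ ⟨s, hs, rfl⟩
    have hd : HasStrictDerivAt z (deriv z s) s :=
      (hC.smooth_z.contDiffAt (hC.isOpen.mem_nhds hs)).hasStrictDerivAt (by simp)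
    rw [← hd.map_nhds_eq (by rw [hb s hs]; exact mul_ne_zero hk (hC.pos s hs).ne')]
    exact image_mem_map (hC.isOpen.mem_nhds hs)
  have hdist : ∀ p : E3, dist p !₂[0, 0, c] = |k|⁻¹ ↔
      p 0 ^ 2 + p 1 ^ 2 + (p 2 - c) ^ 2 = |k|⁻¹ ^ 2 := by
    intro p
    rw [EuclideanSpace.dist_eq, Real.sqrt_eq_iff_eq_sq (by positivity) (by positivity),
      Fin.sum_univ_three]
    simp [Real.dist_eq]
  refine ⟨!₂[0, 0, c], |k|⁻¹, by positivity, {p | p 2 ∈ z '' I},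
    hopen.preimage (by fun_prop : Continuous fun p : E3 => p 2), ?_⟩
  ext p
  constructor
  · rintro ⟨s, hs, t, rfl⟩
    refine ⟨⟨s, hs, rfl⟩, (hdist _).2 ?_⟩
    simp only [param]
    simp
    have hk2 : |k|⁻¹ ^ 2 = k⁻¹ ^ 2 := by rw [inv_pow, sq_abs, inv_pow]
    linear_combination hsph s hs + hk2 + x s ^ 2 * Real.sin_sq_add_cos_sq t
  · rintro ⟨⟨s, hs, hz⟩, hp⟩
    have hp := (hdist _).1 hp
    have hx := hC.pos s hs
    have hxy : p 0 ^ 2 + p 1 ^ 2 = x s ^ 2 := by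
      rw [← hz] at hp
      linear_combination hp - hsph s hs
    -- The angle t is the argument of the horizontal projection of p.
    set w : ℂ := ⟨p 0, p 1⟩ with hw
    have hn : ‖w‖ = x s := by
      rw [Complex.norm_def, Complex.normSq_mk, Real.sqrt_eq_iff_eq_sq (by nlinarith) hx.le]
      linear_combination hxy
    refine ⟨s, hs, Complex.arg w, ?_⟩
    ext i
    fin_cases i
    · simpa [param, hn] using Complex.norm_mul_cos_arg w
    · simpa [param, hn] using Complex.norm_mul_sin_arg w
    · exact hz

/-! ### From the matrix equation to the sphere -/

theorem exists_diagonal_of_matrix (hC : IsProfileCurve I x z)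
    {A : Matrix (Fin 3) (Fin 3) ℝ} (hA : A.det ≠ 0) (h : ∀ s ∈ I, ∀ t : ℝ,
      chengYauVec (param x z) (gaussMap (param x z)) s t =
        WithLp.toLp 2 (A *ᵥ (gaussMap (param x z) s t).ofLp)) :
    ∃ l m : ℝ, l ≠ 0 ∧ m ≠ 0 ∧ (∃ s ∈ I, deriv x s ≠ 0) ∧ (∃ s ∈ I, deriv z s ≠ 0) ∧
      ∀ s ∈ I, HasDerivAt (fun s => meridianCurvature x z s * parallelCurvature x z s)
          ((m - l) * (deriv x s * deriv z s)) s ∧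
        (meridianCurvature x z s + parallelCurvature x z s) *
          (meridianCurvature x z s * parallelCurvature x z s) =
            l * deriv z s ^ 2 + m * deriv x s ^ 2 := by
  set K : ℝ → ℝ := fun s => meridianCurvature x z s * parallelCurvature x z s with hKdef
  set T : ℝ → ℝ := fun s => meridianCurvature x z s + parallelCurvature x z s with hTdef
  have hK : ∀ s ∈ I, HasDerivAt K (deriv K s) s := fun s hs =>
    ((hC.hasDerivAt_meridianCurvature hs).mul
      (hC.hasDerivAt_parallelCurvature hs)).differentiableAt.hasDerivAt
  have comp : ∀ s ∈ I, ∀ t,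
      (deriv K s * deriv x s - T s * K s * deriv z s) * Real.cos t =
        A 0 0 * (-deriv z s * Real.cos t) + A 0 1 * (-deriv z s * Real.sin t) +
          A 0 2 * deriv x s ∧
      (deriv K s * deriv x s - T s * K s * deriv z s) * Real.sin t =
        A 1 0 * (-deriv z s * Real.cos t) + A 1 1 * (-deriv z s * Real.sin t) +
          A 1 2 * deriv x s ∧
      deriv K s * deriv z s + T s * K s * deriv x s =
        A 2 0 * (-deriv z s * Real.cos t) + A 2 1 * (-deriv z s * Real.sin t) +
          A 2 2 * deriv x s := by
    intro s hs t
    have e := h s hs t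
    rw [hC.chengYauVec_gaussMap hs t (hK s hs) rfl rfl, hC.gaussMap_param hs] at e
    have e' := fun i => congrArg (fun v : E3 => v i) e
    have e0 := e' 0
    have e1 := e' 1
    have e2 := e' 2
    simp [Matrix.mulVec, dotProduct, Fin.sum_univ_three] at e0 e1 e2
    refine ⟨?_, ?_, ?_⟩
    · linear_combination e0
    · linear_combination e1
    · linear_combination e2
  have rel : ∀ s ∈ I, (A 0 2 * deriv x s = 0 ∧ A 1 2 * deriv x s = 0) ∧
      (A 0 1 * deriv z s = 0 ∧ A 1 0 * deriv z s = 0 ∧ A 2 0 * deriv z s = 0 ∧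
        A 2 1 * deriv z s = 0) ∧
      deriv K s * deriv x s - T s * K s * deriv z s = -(A 0 0 * deriv z s) ∧
      deriv K s * deriv x s - T s * K s * deriv z s = -(A 1 1 * deriv z s) ∧
      deriv K s * deriv z s + T s * K s * deriv x s = A 2 2 * deriv x s := by
    intro s hs
    -- Four angles suffice to separate the coefficients of 1, cos t and sin t.
    obtain ⟨p0, p1, p2⟩ := comp s hs 0
    obtain ⟨q0, q1, q2⟩ := comp s hs Real.pi
    obtain ⟨u0, u1, u2⟩ := comp s hs (Real.pi / 2)
    obtain ⟨v0, v1, v2⟩ := comp s hs (-(Real.pi / 2))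
    simp at p0 p1 p2 q0 q1 q2 u0 u1 u2 v0 v1 v2
    refine ⟨⟨?_, ?_⟩, ⟨?_, ?_, ?_, ?_⟩, ?_, ?_, ?_⟩ <;> linarith
  -- Otherwise the surface is a cylinder, K = 0, and the first column of A vanishes.
  have hx : ∃ s ∈ I, deriv x s ≠ 0 := by
    by_contra! hx
    have hk : ∀ s ∈ I, meridianCurvature x z s = 0 := fun s hs => by
      have h1 := hC.eq_zero_of_hasDerivAt_of_eqOn_const hs (hC.hasDerivAt_deriv_x hs) hx
      have h2 := hC.unit_speed s hs
      have h3 : deriv z s ≠ 0 := by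
        intro h0; rw [hx s hs, h0] at h2; norm_num at h2
      exact (mul_eq_zero.1 (neg_eq_zero.1 h1)).resolve_right h3
    obtain ⟨s, hs⟩ := hC.isConnected.nonempty
    obtain ⟨-, ⟨r1, r2, r3, r4⟩, r5, r6, -⟩ := rel s hs
    have h2 := hC.unit_speed s hs
    have h3 : deriv z s ≠ 0 := by
      intro h0; rw [hx s hs, h0] at h2; norm_num at h2
    have hK0 : K s = 0 := by simp [hKdef, hk s hs]
    rw [hx s hs, hK0] at r5
    have a0 : A 0 0 = 0 := (mul_eq_zero.1 (by linarith)).resolve_right h3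
    have a1 : A 1 0 = 0 := (mul_eq_zero.1 r2).resolve_right h3
    have a2 : A 2 0 = 0 := (mul_eq_zero.1 r3).resolve_right h3
    exact hA (by rw [Matrix.det_fin_three, a0, a1, a2]; ring)
  -- Otherwise the surface is planar, and the third column of A vanishes.
  have hz : ∃ s ∈ I, deriv z s ≠ 0 := by
    by_contra! hz
    have hp : ∀ s ∈ I, parallelCurvature x z s = 0 := fun s hs => by
      rw [parallelCurvature, hz s hs, zero_div]
    obtain ⟨s, hs⟩ := hC.isConnected.nonempty
    obtain ⟨⟨r1, r2⟩, -, -, -, r7⟩ := rel s hs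
    have h2 := hC.unit_speed s hs
    have h3 : deriv x s ≠ 0 := by
      intro h0; rw [hz s hs, h0] at h2; norm_num at h2
    have hK0 : K s = 0 := by simp [hKdef, hp s hs]
    rw [hz s hs, hK0] at r7
    have a0 : A 0 2 = 0 := (mul_eq_zero.1 r1).resolve_right h3
    have a1 : A 1 2 = 0 := (mul_eq_zero.1 r2).resolve_right h3
    have a2 : A 2 2 = 0 := (mul_eq_zero.1 (by linarith)).resolve_right h3
    exact hA (by rw [Matrix.det_fin_three, a0, a1, a2]; ring)
  have hdet : A 0 0 ^ 2 * A 2 2 ≠ 0 := by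
    obtain ⟨s, hs, h3⟩ := hx
    obtain ⟨⟨r1, r2⟩, -⟩ := rel s hs
    obtain ⟨σ, hσ, h4⟩ := hz
    obtain ⟨-, ⟨t1, t2, t3, t4⟩, t5, t6, -⟩ := rel σ hσ
    have a02 : A 0 2 = 0 := (mul_eq_zero.1 r1).resolve_right h3
    have a12 : A 1 2 = 0 := (mul_eq_zero.1 r2).resolve_right h3
    have a01 : A 0 1 = 0 := (mul_eq_zero.1 t1).resolve_right h4
    have a10 : A 1 0 = 0 := (mul_eq_zero.1 t2).resolve_right h4
    have a11 : A 1 1 = A 0 0 := mul_right_cancel₀ h4 (by linarith)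
    convert hA using 1
    rw [Matrix.det_fin_three, a02, a12, a01, a10, a11]
    ring
  refine ⟨A 0 0, A 2 2, fun h0 => hdet (by rw [h0]; ring), fun h0 => hdet (by rw [h0]; ring),
    hx, hz, fun s hs => ?_⟩
  obtain ⟨-, -, r5, -, r7⟩ := rel s hs
  have hu := hC.unit_speed s hs
  refine ⟨(hK s hs).congr_deriv ?_, ?_⟩
  -- The linear system for K' and T K is a rotation by the unit vector (x', z'), inverted here.
  · linear_combination deriv x s * r5 + deriv z s * r7 - deriv K s * hu
  · change T s * K s = _
    linear_combination deriv x s * r7 - deriv z s * r5 - T s * K s * hu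

theorem eq_of_gauss_curvature_system (hC : IsProfileCurve I x z) {l m : ℝ} (hl : l ≠ 0)
    (hz : ∃ s ∈ I, deriv z s ≠ 0)
    (hK : ∀ s ∈ I, HasDerivAt (fun s => meridianCurvature x z s * parallelCurvature x z s)
      ((m - l) * (deriv x s * deriv z s)) s)
    (hT : ∀ s ∈ I, (meridianCurvature x z s + parallelCurvature x z s) *
      (meridianCurvature x z s * parallelCurvature x z s) =
        l * deriv z s ^ 2 + m * deriv x s ^ 2) : l = m := by
  by_contra hlm
  have hc : m - l ≠ 0 := sub_ne_zero.2 (Ne.symm hlm)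
  have hcont : ContinuousOn (fun s => deriv x s * deriv z s) I :=
    hC.smooth_deriv_x.continuousOn.mul hC.smooth_deriv_z.continuousOn
  set J : Set ℝ := I ∩ (fun s => deriv x s * deriv z s) ⁻¹' {0}ᶜ with hJ
  have hJo : IsOpen J := hcont.isOpen_inter_preimage hC.isOpen isOpen_compl_singleton
  rcases J.eq_empty_or_nonempty with he | hne
  -- If x'z' vanishes identically, its derivative at a point with z' ≠ 0 gives k₁ = 0, so T K = 0
  -- there, against l ≠ 0.
  · have h0 : ∀ s ∈ I, deriv x s * deriv z s = 0 := by
      intro s hs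
      by_contra hn
      exact (he ▸ (⟨hs, hn⟩ : s ∈ J) : s ∈ (∅ : Set ℝ))
    obtain ⟨s, hs, hzs⟩ := hz
    have hxs := (mul_eq_zero.1 (h0 s hs)).resolve_right hzs
    have h1 := hC.eq_zero_of_hasDerivAt_of_eqOn_const hs
      ((hC.hasDerivAt_deriv_x hs).mul (hC.hasDerivAt_deriv_z hs)) h0
    rw [hxs] at h1
    have h2 : meridianCurvature x z s * deriv z s ^ 2 = 0 := by linear_combination -h1
    have hk := (mul_eq_zero.1 h2).resolve_right (pow_ne_zero 2 hzs)
    have h3 := hT s hs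
    rw [hk, hxs] at h3
    have h4 : l * deriv z s ^ 2 = 0 := by linear_combination -h3
    exact mul_ne_zero hl (pow_ne_zero 2 hzs) h4
  · have hI : ∀ s ∈ J, s ∈ I := fun s hs => hs.1
    have hx0 : ∀ s ∈ J, x s ≠ 0 := fun s hs => (hC.pos s hs.1).ne'
    have ha0 : ∀ s ∈ J, deriv x s ≠ 0 := fun s hs => left_ne_zero_of_mul hs.2
    have hb0 : ∀ s ∈ J, deriv z s ≠ 0 := fun s hs => right_ne_zero_of_mul hs.2
    have hu0 : ∀ s ∈ J, parallelCurvature x z s ≠ 0 :=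
      fun s hs => div_ne_zero (hb0 s hs) (hx0 s hs)
    have hzu : ∀ s ∈ J, deriv z s = parallelCurvature x z s * x s := fun s hs => by
      rw [parallelCurvature, div_mul_cancel₀ _ (hx0 s hs)]
    refine no_solution_of_shape_system hJo hne (u := parallelCurvature x z)
      (r := fun s => meridianCurvature x z s / parallelCurvature x z s)
      (q := fun s => (m - l) * x s ^ 2 / parallelCurvature x z s)
      (g := fun s => deriv x s / x s) (m := m) (fun s hs => ?_) (fun s hs => ?_)
      (fun s hs => ?_) (fun s hs => ?_) (fun s hs => div_ne_zero (ha0 s hs) (hx0 s hs)) hu0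
      (fun s hs => div_ne_zero (mul_ne_zero hc (pow_ne_zero 2 (hx0 s hs))) (hu0 s hs))
    · have := hu0 s hs
      refine (hC.hasDerivAt_parallelCurvature hs.1).congr_deriv ?_
      field_simp
    · have hu := hu0 s hs
      have hxs := hx0 s hs
      have hd := hC.hasDerivAt_meridianCurvature hs.1
      have hp := hC.hasDerivAt_parallelCurvature hs.1
      have e := (hd.mul hp).unique (hK s hs.1)
      rw [hzu s hs] at e
      refine (hd.div hp hu).congr_deriv ?_
      field_simp at e ⊢
      linear_combination e
    · have hu := hu0 s hs
      have hxs := hx0 s hs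
      refine ((((hC.hasDerivAt_x hs.1).pow 2).const_mul (m - l)).div
        (hC.hasDerivAt_parallelCurvature hs.1) hu).congr_deriv ?_
      simp
      field_simp
      ring
    · have hu := hu0 s hs
      have e := hT s hs.1
      have e' := hC.unit_speed s hs.1
      rw [hzu s hs] at e e'
      field_simp
      -- With z' = k₂x and unit speed, the right side l z'² + m x'² equals m - k₂³q.
      linear_combination e + m * e'

theorem isOpenPartOfRoundSphere_of_matrix (hC : IsProfileCurve I x z)
    {A : Matrix (Fin 3) (Fin 3) ℝ} (hA : A.det ≠ 0) (h : ∀ s ∈ I, ∀ t : ℝ,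
      chengYauVec (param x z) (gaussMap (param x z)) s t =
        WithLp.toLp 2 (A *ᵥ (gaussMap (param x z) s t).ofLp)) :
    IsOpenPartOfRoundSphere (surface I x z) := by
  obtain ⟨l, m, hl, -, hx, hz, hKT⟩ := hC.exists_diagonal_of_matrix hA h
  obtain rfl := hC.eq_of_gauss_curvature_system hl hz (fun s hs => (hKT s hs).1)
    (fun s hs => (hKT s hs).2)
  obtain ⟨K, hK⟩ := hC.eqOn_const_of_hasDerivAt_zero fun s hs =>
    (hKT s hs).1.congr_deriv (by ring)
  have hTK : ∀ s ∈ I, (meridianCurvature x z s + parallelCurvature x z s) * K = l := by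
    intro s hs
    rw [← hK s hs]
    linear_combination (hKT s hs).2 + l * hC.unit_speed s hs
  have hK0 : K ≠ 0 := by
    rintro rfl
    obtain ⟨s, hs⟩ := hC.isConnected.nonempty
    exact hl (by simpa using (hTK s hs).symm)
  have hT : ∀ s ∈ I, meridianCurvature x z s + parallelCurvature x z s = l / K :=
    fun s hs => eq_div_of_mul_eq hK0 (hTK s hs)
  -- The constant T² - 4K is (k₁ - k₂)², so one umbilic point makes all points umbilic. Where x' ≠
  -- 0, constancy of T and K with Codazzi gives such a point.
  have hD : (l / K) ^ 2 - 4 * K = 0 := by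
    obtain ⟨s, hs, hxs⟩ := hx
    have hd := hC.hasDerivAt_meridianCurvature hs
    have hp := hC.hasDerivAt_parallelCurvature hs
    have e1 := hC.eq_zero_of_hasDerivAt_of_eqOn_const hs (hd.add hp) hT
    have e2 := hC.eq_zero_of_hasDerivAt_of_eqOn_const hs (hd.mul hp) hK
    have e3 : deriv x s / x s *
        (meridianCurvature x z s - parallelCurvature x z s) ^ 2 = 0 := by
      linear_combination e2 - parallelCurvature x z s * e1
    have e4 := (mul_eq_zero.1 e3).resolve_left (div_ne_zero hxs (hC.pos s hs).ne')
    rw [← hT s hs, ← hK s hs]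
    linear_combination e4
  have heq : ∀ s ∈ I, meridianCurvature x z s = parallelCurvature x z s := by
    intro s hs
    rw [← hT s hs, ← hK s hs] at hD
    refine sub_eq_zero.1 ((pow_eq_zero_iff two_ne_zero).1 ?_)
    linear_combination hD
  refine hC.isOpenPartOfRoundSphere_of_curvatures_eq (k := l / K / 2)
    (div_ne_zero (div_ne_zero hl hK0) two_ne_zero) (fun s hs => ?_) (fun s hs => ?_)
  · linarith [hT s hs, heq s hs]
  · linarith [hT s hs, heq s hs]

end IsProfileCurve

end RevolutionSurface

theorem corollary4p2 (I : Set ℝ) (x z : ℝ → ℝ) (hC : RevolutionSurface.IsProfileCurve I x z) :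
    RevolutionSurface.IsOpenPartOfRoundSphere (RevolutionSurface.surface I x z) ↔
      ∃ A : Matrix (Fin 3) (Fin 3) ℝ, A.det ≠ 0 ∧
        ∀ s ∈ I, ∀ t : ℝ,
          RevolutionSurface.chengYauVec (RevolutionSurface.param x z)
              (RevolutionSurface.gaussMap (RevolutionSurface.param x z)) s t =
            WithLp.toLp 2
              (A *ᵥ (RevolutionSurface.gaussMap (RevolutionSurface.param x z) s t).ofLp) := by
  refine ⟨hC.exists_matrix_of_isOpenPartOfRoundSphere, ?_⟩
  rintro ⟨A, hA, h⟩
  exact hC.isOpenPartOfRoundSphere_of_matrix hA h
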